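/- Let $q$ be an indeterminate, with $[m]_q=1+q+\dots+q^{m-1}$, $[m]_q!=[1]_q[2]_q\cdots[m]_q$ and $\begin{bmatrix} i\\ j\end{bmatrix}_q=\dfrac{[i]_q!}{[j]_q!\,[i-j]_q!}$ for $0\le j\le i$. For a permutation $\sigma$ of $\{1,\dots,n\}$, a right-to-left maximum of $\sigma$ is an index $i$ such that $\sigma(i)>\sigma(j)$ for all $j$ with $i<j\le n$, and a special inversion of $\sigma$ is a pair $(i,j)$ with $1\le i<j\le n$ and $\sigma(i)>\sigma(j)$ such that $\sigma(i)<\sigma(l)$ for some $l$ with $j<l\le n$. Let $\mathrm{inv}'(\sigma)$ be the number of special inversions of $\sigma$, and let $$S_1[n,k]=\sum_{\sigma} q^{\mathrm{inv}'(\sigma)},$$ where $\sigma$ runs over the permutations of $\{1,\dots,n\}$ with exactly $k$ right-to-left maxima. For integers $u,v$ let $\binom uv$ be the usual binomial coefficient if $0\le v\le u$, let $\binom uu=1$ for all $u$ (also negative), and let $\binom uv=0$ in all other cases. For integers $0\le k\le n$ and $0\le j\le i\le n-k$ put $$B^{n,k}_{i,j}=\binom{n+j-1}{k-1}\binom{n-i-1}{k-1}-\binom{n+j}{k-1}\binom{n-i-2}{k-1}.$$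 Then, for all integers $0\le k\le n$, $$(1-q)^{n-k}\,S_1[n,k]=\sum_{j=0}^{n-k}\ \sum_{i=j}^{n-k}(-1)^j\,B^{n,k}_{i,j}\,q^{\binom{j+1}{2}}\begin{bmatrix} i\\ j\end{bmatrix}_q .$$ -/

import Mathlib

namespace QStirling

/-- The set of right-to-left maxima of `σ`: positions `i` with `σ i > σ j` for all `j > i`. -/
def rlmSet {n : ℕ} (σ : Equiv.Perm (Fin n)) : Finset (Fin n) :=
  Finset.univ.filter fun i => ∀ j : Fin n, i < j → σ j < σ i

/-- The number of right-to-left maxima of `σ`. -/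
def rlm {n : ℕ} (σ : Equiv.Perm (Fin n)) : ℕ := (rlmSet σ).card

/-- The set of special inversions of `σ`: inversions `(i, j)` (that is, `i < j` and
`σ i > σ j`) such that some `k > j` satisfies `σ i < σ k`. -/
def specialInvSet {n : ℕ} (σ : Equiv.Perm (Fin n)) : Finset (Fin n × Fin n) :=
  Finset.univ.filter fun p =>
    (p.1 < p.2 ∧ σ p.2 < σ p.1) ∧ ∃ k : Fin n, p.2 < k ∧ σ p.1 < σ k

/-- The number of special inversions of `σ`. -/
def specialInv {n : ℕ} (σ : Equiv.Perm (Fin n)) : ℕ := (specialInvSet σ).card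

/-- The `q`-Stirling number of the first kind `S₁[n,k]`: the sum of `q ^ inv'(σ)` over the
permutations `σ` of an `n`-element chain having `k` right-to-left maxima. -/
def qStirlingFirst {K : Type*} [CommSemiring K] (q : K) (n k : ℕ) : K :=
  ∑ σ ∈ (Finset.univ : Finset (Equiv.Perm (Fin n))).filter (fun σ => rlm σ = k),
    q ^ specialInv σ

/-- The `q`-integer `[m]_q = 1 + q + ⋯ + q ^ (m - 1)`. -/
def qInt {K : Type*} [CommSemiring K] (q : K) (m : ℕ) : K :=
  ∑ i ∈ Finset.range m, q ^ i

/-- The `q`-factorial `[m]_q! = [1]_q [2]_q ⋯ [m]_q`. -/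
def qFact {K : Type*} [CommSemiring K] (q : K) (m : ℕ) : K :=
  ∏ i ∈ Finset.Icc 1 m, qInt q i

/-- The `q`-binomial coefficient `[n]_q! / ([k]_q! [n-k]_q!)` for `k ≤ n`, and `0` for `k > n`. -/
def qBinom {K : Type*} [Field K] (q : K) (n k : ℕ) : K :=
  if k ≤ n then qFact q n / (qFact q k * qFact q (n - k)) else 0

/-- Binomial coefficients with integer entries, under the convention that
`C(u,u) = 1` for every integer `u` (in particular `C(-1,-1) = C(-2,-2) = 1`),
that `C(u,v) = 0` for `v < 0`, `v < u`, and that `C(u,v) = 0` for `u < v`. -/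
def binomZ (u v : ℤ) : ℤ :=
  if u = v then 1
  else if v < 0 ∨ u < v then 0
  else (u.toNat.choose v.toNat : ℤ)

/-- The integers `B^{n,k}_{i,j}`. -/
def coeffB (n k i j : ℕ) : ℤ :=
  binomZ ((n : ℤ) + j - 1) ((k : ℤ) - 1) * binomZ ((n : ℤ) - i - 1) ((k : ℤ) - 1)
    - binomZ ((n : ℤ) + j) ((k : ℤ) - 1) * binomZ ((n : ℤ) - i - 2) ((k : ℤ) - 1)

end QStirling

/-!
The formula comes from refining `S₁[n,k]` by a threshold. For `h ≤ N` count the permutations `σ`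
of `Fin N` by the inversions `(i, j)` with `j < h` or with an entry larger than `σ i` to the right
of `j` (`thrInv`), and by the right-to-left maxima at positions `≥ h` (`thrRlm`); `h = 0` gives
back `S₁`. Removing the maximum, at position `p`, yields for the generating function `C_{N,k}(h)`
(`thrGF_succ_eq`)

  `C_{N+1,k}(h) = [h]_q C_{N,k}(h-1) + ∑_{p=h}^{N} C_{N,k-1}(p)`.

Put `N = h + n` and write `(1-q)^n C_{h+n,k}(h) = (1-q)^k [h]_q! ∑_{g ≤ h} R_{n,k}(g)`. The
recurrence becomes

  `R_{n+1,k}(h) = (1-q^{h+1}) R_{n,k}(h+1) + ∑_{g ≤ h} R_{n,k-1}(g)`.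

Let `s` and `x` mark `n` and `k`, and let `α`, `β` be given by `α β = s`,
`(1-α)(1-β) = s x`, with `β` divisible by `s`. Apart from initial terms, this three-term recurrence
in `h` is solved by

  `R(h) = s x ∑_d (-1)^d q^{C(d+1,2)} [h+d,h]_q β^d α^{-h-d-1} / ((1-β)(1-qβ)⋯(1-q^{h+d}β))`,

and the coefficient of `s^{n-1} x^{k-1}` in `β^i α^{-j-1}` is `B^{n,k}_{i,j}`. The proof avoids the
series: `R_{n,k}(h)` is replaced by the finite double sum `levelSum` of products of `kernelCoeff`
(the coefficients in `β` and `α⁻¹`) and `binomDet` (the numbers `B`). The relation `α β = s` means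
that `B` depends only on `n + j` and `n - i`, and `(1-α)(1-β) = s x` is
`binomDet_second_difference`. The recurrence for the kernel then holds term by term, by the two
`q`-Pascal rules (`kernelCoeff_succ_succ`), so `levelSum` satisfies the recurrence for `R`
(`levelSum_succ`), and at `h = 0` it is the right-hand side of the theorem.
-/

namespace QStirling

/-! ### Gaussian binomial coefficients -/

/-- The Gaussian binomial coefficient `[n, k]_q`, defined in any commutative semiring by the
`q`-Pascal recursion, so that no division is needed. -/
def gauss {K : Type*} [CommSemiring K] (q : K) : ℕ → ℕ → K
  | _, 0 => 1
  | 0, _ + 1 => 0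
  | n + 1, k + 1 => gauss q n k + q ^ (k + 1) * gauss q n (k + 1)

section Gauss

variable {K : Type*} [CommRing K] (q : K)

@[simp]
theorem gauss_zero_right (n : ℕ) : gauss q n 0 = 1 := by
  cases n <;> rfl

theorem gauss_succ_succ (n k : ℕ) :
    gauss q (n + 1) (k + 1) = gauss q n k + q ^ (k + 1) * gauss q n (k + 1) := rfl

theorem gauss_eq_zero_of_lt : ∀ {n k : ℕ}, n < k → gauss q n k = 0
  | 0, k + 1, _ => rfl
  | n + 1, k + 1, h => by
    rw [gauss_succ_succ, gauss_eq_zero_of_lt (by omega : n < k),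
      gauss_eq_zero_of_lt (by omega : n < k + 1)]
    simp

@[simp]
theorem gauss_self (n : ℕ) : gauss q n n = 1 := by
  induction n with
  | zero => rfl
  | succ n ih => rw [gauss_succ_succ, ih, gauss_eq_zero_of_lt q n.lt_succ_self]; simp

theorem one_sub_pow_mul_gauss_succ (k d : ℕ) :
    (1 - q ^ (k + 1)) * gauss q (k + d) (k + 1) = (1 - q ^ d) * gauss q (k + d) k := by
  obtain ⟨n, hn⟩ : ∃ n, n = k + d := ⟨_, rfl⟩
  rw [← hn]
  induction n generalizing k d with
  | zero =>
    obtain ⟨rfl, rfl⟩ : k = 0 ∧ d = 0 := by omega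
    simp [gauss]
  | succ n ih =>
    rcases k with _ | k
    · obtain rfl : d = n + 1 := by omega
      have h := ih 0 n (by omega)
      rw [gauss_succ_succ]
      simp only [zero_add, pow_one, gauss_zero_right, mul_one] at h ⊢
      linear_combination q * h
    · rcases d with _ | d
      · rw [gauss_eq_zero_of_lt q (by omega : n + 1 < k + 1 + 1)]
        simp
      · have h₁ := ih (k + 1) d (by omega)
        have h₂ := ih k (d + 1) (by omega)
        rw [gauss_succ_succ, gauss_succ_succ]
        linear_combination q ^ (k + 2) * h₁ + h₂

/-- The second `q`-Pascal rule. -/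
theorem gauss_succ_succ' (k d : ℕ) :
    gauss q (k + d + 1) (k + 1) = q ^ d * gauss q (k + d) k + gauss q (k + d) (k + 1) := by
  rw [gauss_succ_succ]
  linear_combination -(one_sub_pow_mul_gauss_succ q k d)

theorem one_sub_mul_qInt (m : ℕ) : (1 - q) * qInt q m = 1 - q ^ m := by
  rw [qInt, mul_comm, ← neg_sub q 1, mul_neg, geom_sum_mul]
  ring

theorem qInt_add (a b : ℕ) : qInt q (a + b) = qInt q a + q ^ a * qInt q b := by
  simp only [qInt, Finset.sum_range_add, Finset.mul_sum, pow_add]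

theorem qFact_zero : qFact q 0 = 1 := by simp [qFact]

theorem qFact_succ (m : ℕ) : qFact q (m + 1) = qFact q m * qInt q (m + 1) := by
  rw [qFact, Finset.prod_Icc_succ_top (by omega), qFact]

theorem gauss_mul_qFact (k d : ℕ) :
    gauss q (k + d) k * (qFact q k * qFact q d) = qFact q (k + d) := by
  obtain ⟨n, hn⟩ : ∃ n, n = k + d := ⟨_, rfl⟩
  rw [← hn]
  induction n generalizing k d with
  | zero =>
    obtain ⟨rfl, rfl⟩ : k = 0 ∧ d = 0 := by omega
    simp [qFact_zero]
  | succ n ih =>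
    rcases k with _ | k
    · obtain rfl : d = n + 1 := by omega
      simp [qFact_zero]
    · have h₁ := ih k d (by omega)
      rw [gauss_succ_succ, qFact_succ q n, qFact_succ q k]
      rcases d with _ | d
      · obtain rfl : n = k := by omega
        rw [gauss_eq_zero_of_lt q n.lt_succ_self]
        simp [qFact_zero]
      · have h₂ := ih (k + 1) d (by omega)
        rw [qFact_succ] at h₁ h₂ ⊢
        have hI : qInt q (n + 1) = qInt q (k + 1) + q ^ (k + 1) * qInt q (d + 1) := by
          rw [← qInt_add, hn]
        rw [hI]
        linear_combination qInt q (k + 1) * h₁ + q ^ (k + 1) * qInt q (d + 1) * h₂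

end Gauss

/-! ### The kernel coefficients -/

section Kernel

variable {K : Type*} [CommRing K] (q : K)

/-- The coefficient of `β ^ m * α ^ (-(h + d) - 1)` in the series `R(h) / (s x)` of the
module comment: `(-1) ^ d q ^ C(d + 1, 2) [h + d, h] [m + h, h + d]`. -/
def kernelCoeff (h m d : ℕ) : K :=
  (-1) ^ d * q ^ (d + 1).choose 2 * gauss q (h + d) h * gauss q (m + h) (h + d)

/-- `kernelCoeff` at level `h - 1`, with the value `0` at the missing level `-1`. -/
def prevCoeff : ℕ → ℕ → ℕ → K
  | 0, _, _ => 0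
  | h + 1, m, d => kernelCoeff q h m d

theorem kernelCoeff_eq_zero {m d : ℕ} (hd : m < d) (h : ℕ) : kernelCoeff q h m d = 0 := by
  rw [kernelCoeff, gauss_eq_zero_of_lt q (by omega : m + h < h + d), mul_zero]

theorem kernelCoeff_zero_zero (h : ℕ) : kernelCoeff q h 0 0 = 1 := by
  simp [kernelCoeff]

theorem kernelCoeff_succ_zero (h m : ℕ) :
    kernelCoeff q h (m + 1) 0 - prevCoeff q h (m + 1) 0 = q ^ h * kernelCoeff q h m 0 := by
  rcases h with _ | h
  · simp [kernelCoeff, prevCoeff]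
  · simp only [kernelCoeff, prevCoeff, add_zero, gauss_self]
    rw [show m + 1 + (h + 1) = (m + 1 + h) + 1 by ring, gauss_succ_succ,
      show m + (h + 1) = m + 1 + h by ring]
    simp

/-- The recurrence in `h` for the coefficient of a single power of `α`: absorption turns
`(1 - q ^ (h + 1)) [h + e + 1, h + 1]` into `(1 - q ^ (e + 1)) [h + e + 1, h]`, and what remains is
one `q`-Pascal rule for each of the two Gaussian binomials. -/
theorem kernelCoeff_succ_succ (h m e : ℕ) :
    kernelCoeff q h (m + 1) (e + 1) - prevCoeff q h (m + 1) (e + 1) =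
      (1 - q ^ (h + 1)) * kernelCoeff q (h + 1) m e + q ^ h * kernelCoeff q h m (e + 1)
        - kernelCoeff q h m e := by
  have hc : (e + 1 + 1).choose 2 = (e + 1).choose 2 + (e + 1) := by
    rw [Nat.choose_succ_succ' (e + 1) 1, Nat.choose_one_right, add_comm]
  have habs := one_sub_pow_mul_gauss_succ q h (e + 1)
  have hp := gauss_succ_succ q (m + h) (h + e)
  simp only [kernelCoeff, hc]
  rw [show m + 1 + h = m + h + 1 by ring, show m + (h + 1) = m + h + 1 by ring,
    show h + 1 + e = h + e + 1 by ring]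
  simp only [← add_assoc h e 1] at habs ⊢
  rcases h with _ | h
  · simp only [prevCoeff, zero_add, add_zero, gauss_zero_right, pow_zero, mul_one, one_mul] at *
    rw [pow_add, hp, pow_succ]
    linear_combination
      (-(-1) ^ e * q ^ (e + 1).choose 2 * (gauss q m e + q ^ (e + 1) * gauss q m (e + 1))) * habs
  · have hp' := gauss_succ_succ' q h (e + 1)
    simp only [prevCoeff, kernelCoeff, hc]
    rw [show m + 1 + h = m + (h + 1) by ring]
    simp only [← add_assoc h e 1] at hp' ⊢
    rw [show h + 1 + e = h + e + 1 by ring] at *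
    rw [pow_add, hp, pow_succ (-1 : K)]
    linear_combination
      (-(-1) ^ e * q ^ (e + 1).choose 2 *
        (gauss q (m + (h + 1)) (h + e + 1) +
          q ^ (h + e + 1 + 1) * gauss q (m + (h + 1)) (h + e + 1 + 1))) * habs
      - (-1) ^ e * q ^ (e + 1).choose 2 * gauss q (m + (h + 1)) (h + e + 1) * hp'

end Kernel

/-! ### Sums against the kernel -/

section KernelSum

variable {K : Type*} [CommRing K] (q : K)

/-- The sum `∑ c(h, m, d) b(x + d, y - m)` over `m, d < M`, where `c` is `kernelCoeff` and `b` is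
an arbitrary function on `ℤ × ℤ`. -/
def kernelSum (b : ℤ → ℤ → K) (M h : ℕ) (x y : ℤ) : K :=
  ∑ m ∈ Finset.range M, ∑ d ∈ Finset.range M, kernelCoeff q h m d * b (x + d) (y - m)

/-- `kernelSum` at level `h - 1`, with the value `0` at the missing level `-1`. -/
def prevSum (b : ℤ → ℤ → K) (M : ℕ) : ℕ → ℤ → ℤ → K
  | 0, _, _ => 0
  | h + 1, x, y => kernelSum q b M h x y

theorem prevSum_eq_sum (b : ℤ → ℤ → K) (M h : ℕ) (x y : ℤ) :
    prevSum q b M h x y =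
      ∑ m ∈ Finset.range M, ∑ d ∈ Finset.range M, prevCoeff q h m d * b (x + d) (y - m) := by
  cases h <;> simp [prevSum, prevCoeff, kernelSum]

/-- The contribution of a fixed `m` to `kernelSum_sub_prevSum`. -/
theorem sum_kernelCoeff_sub_prevCoeff (f : ℤ → K) {M m : ℕ} (hm : m + 1 < M) (h : ℕ) (x : ℤ) :
    ∑ d ∈ Finset.range M, (kernelCoeff q h (m + 1) d - prevCoeff q h (m + 1) d) * f (x + d) =
      (1 - q ^ (h + 1)) * ∑ d ∈ Finset.range M, kernelCoeff q (h + 1) m d * f (x + 1 + d)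
        + q ^ h * ∑ d ∈ Finset.range M, kernelCoeff q h m d * f (x + d)
        - ∑ d ∈ Finset.range M, kernelCoeff q h m d * f (x + 1 + d) := by
  obtain ⟨M, rfl⟩ : ∃ L, M = L + 1 := ⟨M - 1, by omega⟩
  -- The shift `d ↦ d + 1` matches the arguments `x + 1 + d`; the terms `d = M` vanish.
  rw [Finset.sum_range_succ' _ M, Finset.sum_range_succ' (fun d => kernelCoeff q h m d * f (x + d)),
    Finset.sum_range_succ (fun d => kernelCoeff q (h + 1) m d * f (x + 1 + d)),
    Finset.sum_range_succ (fun d => kernelCoeff q h m d * f (x + 1 + d)),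
    kernelCoeff_eq_zero q (by omega : m < M), kernelCoeff_eq_zero q (by omega : m < M),
    kernelCoeff_succ_zero]
  have hs : ∀ d : ℕ, f (x + ((d + 1 : ℕ) : ℤ)) = f (x + 1 + d) := fun d => by
    congr 1; push_cast; ring
  simp only [hs, kernelCoeff_succ_succ, sub_mul, add_mul, Finset.sum_add_distrib,
    Finset.sum_sub_distrib, mul_add, Finset.mul_sum, mul_assoc]
  ring

/-- The relation between the kernel sums at the levels `h - 1`, `h` and `h + 1`. It holds
coefficientwise in `b`, except for the terms with `m = 0` on the left: these cancel for `h > 0`, and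
for `h = 0` what remains is `b x (y + 1)`, which vanishes by `hdiag`. -/
theorem kernelSum_sub_prevSum (b : ℤ → ℤ → K) {M : ℕ} {x y : ℤ} (hM : y + 1 < M) (h : ℕ)
    (hneg : ∀ u v : ℤ, v < 0 → b u v = 0) (hdiag : h = 0 → b x (y + 1) = 0) :
    kernelSum q b M h x (y + 1) - prevSum q b M h x (y + 1) =
      (1 - q ^ (h + 1)) * kernelSum q b M (h + 1) (x + 1) y + q ^ h * kernelSum q b M h x y
        - kernelSum q b M h (x + 1) y := by
  rcases Nat.eq_zero_or_pos M with rfl | _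
  · cases h <;> simp [kernelSum, prevSum]
  obtain ⟨M, rfl⟩ : ∃ L, M = L + 1 := ⟨M - 1, by omega⟩
  -- The bound on `M` kills the terms with `m = M`, which the shift `m ↦ m + 1` leaves over.
  have hy : ∀ u : ℤ, b u (y - M) = 0 := fun u => hneg _ _ (by push_cast at hM; omega)
  have hzero : ∑ d ∈ Finset.range (M + 1),
      (kernelCoeff q h 0 d - prevCoeff q h 0 d) * b (x + d) (y + 1) = 0 := by
    refine Finset.sum_eq_zero fun d _ => ?_
    rcases d with _ | d
    · rcases h with _ | h
      · simp [hdiag rfl]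
      · simp [prevCoeff, kernelCoeff_zero_zero]
    · rw [kernelCoeff_eq_zero q d.succ_pos]
      rcases h with _ | h
      · simp [prevCoeff]
      · simp [prevCoeff, kernelCoeff_eq_zero q d.succ_pos]
  have hs : ∀ m : ℕ, y + 1 - ((m + 1 : ℕ) : ℤ) = y - m := fun m => by push_cast; ring
  rw [prevSum_eq_sum, kernelSum, ← Finset.sum_sub_distrib]
  simp only [← Finset.sum_sub_distrib, ← sub_mul]
  rw [Finset.sum_range_succ']
  simp only [hs, Nat.cast_zero, sub_zero]
  have hm : ∀ m ∈ Finset.range M, _ := fun m hm =>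
    sum_kernelCoeff_sub_prevCoeff q (fun u => b u (y - m))
      (by simpa using hm : m + 1 < M + 1) h x
  rw [hzero, add_zero, Finset.sum_congr rfl hm]
  simp only [kernelSum]
  rw [Finset.sum_range_succ (fun m => ∑ d ∈ Finset.range (M + 1),
      kernelCoeff q (h + 1) m d * b (x + 1 + d) (y - m)),
    Finset.sum_range_succ (fun m => ∑ d ∈ Finset.range (M + 1),
      kernelCoeff q h m d * b (x + d) (y - m)),
    Finset.sum_range_succ (fun m => ∑ d ∈ Finset.range (M + 1),
      kernelCoeff q h m d * b (x + 1 + d) (y - m))]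
  simp only [hy, mul_zero, Finset.sum_const_zero, add_zero, Finset.sum_sub_distrib,
    Finset.sum_add_distrib, Finset.mul_sum]

end KernelSum

/-! ### Binomial determinants -/

/-- The binomial coefficient `C(u, v)` for an integer `u`, with the value `0` for `u < 0`. -/
def intChoose (v : ℕ) (u : ℤ) : ℤ :=
  if 0 ≤ u then (u.toNat.choose v : ℤ) else 0

theorem intChoose_of_neg (v : ℕ) {u : ℤ} (hu : u < 0) : intChoose v u = 0 :=
  if_neg (by omega)

theorem intChoose_natCast (v u : ℕ) : intChoose v u = u.choose v := by
  simp [intChoose]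

theorem intChoose_succ (v : ℕ) (u : ℤ) :
    intChoose (v + 1) (u + 1) = intChoose v u + intChoose (v + 1) u := by
  rcases lt_trichotomy u (-1) with hu | rfl | hu
  · simp [intChoose_of_neg, show u + 1 < 0 by omega, show u < 0 by omega]
  · simp [intChoose]
  · lift u to ℕ using by omega
    rw [← Nat.cast_succ]
    simp only [intChoose_natCast, Nat.choose_succ_succ']
    push_cast
    ring

/-- The antisymmetric binomial determinant `C(x, v) C(y, v) - C(x + 1, v) C(y - 1, v)`; the
numbers `B^{n,k}_{i,j}` are its values at `v = k - 1`, `x = n + j - 1`, `y = n - i - 1`. -/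
def binomDet (v : ℕ) (x y : ℤ) : ℤ :=
  intChoose v x * intChoose v y - intChoose v (x + 1) * intChoose v (y - 1)

theorem binomDet_of_neg (v : ℕ) (x : ℤ) {y : ℤ} (hy : y < 0) : binomDet v x y = 0 := by
  simp [binomDet, intChoose_of_neg, hy, show y - 1 < 0 by omega]

theorem binomDet_self_succ (v : ℕ) (x : ℤ) : binomDet v x (x + 1) = 0 := by
  rw [binomDet, add_sub_cancel_right]
  ring

theorem binomDet_of_lt {v : ℕ} (x : ℤ) {y : ℤ} (hy : y < v) : binomDet v x y = 0 := by
  have h : ∀ u : ℤ, u < v → intChoose v u = 0 := fun u hu => by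
    rw [intChoose]
    split_ifs
    · rw [Nat.choose_eq_zero_of_lt (by omega), Nat.cast_zero]
    · rfl
  rw [binomDet, h y hy, h (y - 1) (by omega)]
  simp

theorem binomDet_second_difference (v : ℕ) (x y : ℤ) :
    binomDet (v + 1) (x + 1) (y + 1) - binomDet (v + 1) x (y + 1) - binomDet (v + 1) (x + 1) y
      + binomDet (v + 1) x y = binomDet v x y := by
  have h₁ := intChoose_succ v x
  have h₂ := intChoose_succ v (x + 1)
  have h₃ := intChoose_succ v y
  have h₄ := intChoose_succ v (y - 1)
  rw [sub_add_cancel] at h₄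
  simp only [binomDet, add_sub_cancel_right, h₂, h₁, h₃, h₄]
  ring

theorem binomDet_zero {x y : ℤ} (hx : 0 ≤ x) : binomDet 0 x y = if y = 0 then 1 else 0 := by
  simp only [binomDet, intChoose, Nat.choose_zero_right]
  split_ifs <;> omega

theorem coeffB_succ (n v i j : ℕ) :
    coeffB n (v + 1) i j = binomDet v (n + j - 1) (n - i - 1) := by
  have h : ∀ u : ℤ, binomZ u (((v + 1 : ℕ) : ℤ) - 1) = intChoose v u := fun u => by
    simp only [binomZ, intChoose, Nat.cast_succ, add_sub_cancel_right, Int.toNat_natCast]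
    split_ifs with h₁ h₂ h₃ h₃ h₃
    · simp [h₁]
    · omega
    · rw [Nat.choose_eq_zero_of_lt (by omega), Nat.cast_zero]
    · rfl
    · rfl
    · omega
  simp only [coeffB, h, binomDet]
  rw [sub_add_cancel, sub_sub (n - i : ℤ) 1 1, one_add_one_eq_two]

theorem coeffB_zero {n : ℕ} (hn : 0 < n) (i j : ℕ) : coeffB n 0 i j = 0 := by
  have h : ∀ u : ℤ, u ≠ -1 → binomZ u (((0 : ℕ) : ℤ) - 1) = 0 := fun u hu => by
    simp only [binomZ, Nat.cast_zero, zero_sub]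
    rw [if_neg hu, if_pos (by norm_num)]
  rw [coeffB, h _ (by omega), h ((n : ℤ) + j) (by omega)]
  simp

/-! ### Permutations with a threshold, and removal of the maximum -/

/-- The number of inversions `(i, j)` of `σ` such that `j < h` or some `l > j` satisfies
`σ i < σ l`: the special inversions that `σ` has once an entry larger than all of its entries
is put before position `h`. -/
def thrInv {n : ℕ} (h : ℕ) (σ : Equiv.Perm (Fin n)) : ℕ :=
  ∑ i : Fin n, ∑ j : Fin n,
    if (i < j ∧ σ j < σ i) ∧ ((j : ℕ) < h ∨ ∃ l : Fin n, j < l ∧ σ i < σ l) then 1 else 0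

/-- The number of right-to-left maxima of `σ` at the positions `i ≥ h`. -/
def thrRlm {n : ℕ} (h : ℕ) (σ : Equiv.Perm (Fin n)) : ℕ :=
  ∑ i : Fin n, if h ≤ (i : ℕ) ∧ ∀ j : Fin n, i < j → σ j < σ i then 1 else 0

theorem thrInv_zero {n : ℕ} (σ : Equiv.Perm (Fin n)) : thrInv 0 σ = specialInv σ := by
  rw [specialInv, specialInvSet, Finset.card_filter, ← Finset.univ_product_univ,
    Finset.sum_product]
  simp [thrInv]

theorem thrRlm_zero {n : ℕ} (σ : Equiv.Perm (Fin n)) : thrRlm 0 σ = rlm σ := by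
  rw [rlm, rlmSet, Finset.card_filter]
  simp [thrRlm]

/-- The permutation of `Fin (n + 1)` obtained from `τ` by inserting a new maximum at
position `p`. -/
def insMax {n : ℕ} (p : Fin (n + 1)) (τ : Equiv.Perm (Fin n)) : Equiv.Perm (Fin (n + 1)) :=
  (finSuccEquiv' p).trans (τ.optionCongr.trans (finSuccEquiv' (Fin.last n)).symm)

@[simp]
theorem insMax_self {n : ℕ} (p : Fin (n + 1)) (τ : Equiv.Perm (Fin n)) :
    insMax p τ p = Fin.last n := by
  simp [insMax]

@[simp]
theorem insMax_succAbove {n : ℕ} (p : Fin (n + 1)) (τ : Equiv.Perm (Fin n)) (i : Fin n) :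
    insMax p τ (p.succAbove i) = (τ i).castSucc := by
  simp [insMax]

theorem insMax_bijective (n : ℕ) :
    Function.Bijective fun x : Fin (n + 1) × Equiv.Perm (Fin n) => insMax x.1 x.2 := by
  rw [Fintype.bijective_iff_injective_and_card]
  refine ⟨fun ⟨p, τ⟩ ⟨p', τ'⟩ h => ?_, by simp [Fintype.card_perm, Nat.factorial_succ]⟩
  simp only at h
  obtain rfl : p = p' := by
    apply (insMax p' τ').injective
    rw [insMax_self, ← h, insMax_self]
  refine Prod.ext rfl (Equiv.ext fun i => ?_)
  have := congrArg (fun σ : Equiv.Perm (Fin (n + 1)) => σ (p.succAbove i)) h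
  simpa using this

theorem exists_succAbove_lt_iff {n : ℕ} (p : Fin (n + 1)) (τ : Equiv.Perm (Fin n))
    (i j : Fin n) :
    (∃ l, p.succAbove j < l ∧ insMax p τ (p.succAbove i) < insMax p τ l) ↔
      (j : ℕ) < p ∨ ∃ l, j < l ∧ τ i < τ l := by
  rw [Fin.exists_iff_succAbove p]
  simp only [insMax_self, insMax_succAbove, Fin.castSucc_lt_last, and_true,
    Fin.succAbove_lt_succAbove_iff, Fin.castSucc_lt_castSucc_iff,
    Fin.succAbove_lt_iff_castSucc_lt]
  rfl

theorem val_succAbove {n : ℕ} (p : Fin (n + 1)) (i : Fin n) :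
    (p.succAbove i : ℕ) = if (i : ℕ) < p then (i : ℕ) else i + 1 := by
  rw [Fin.succAbove]
  simp only [Fin.lt_def, Fin.val_castSucc]
  split_ifs <;> simp

/-- The pairs `(p, j)` with `p < j < h` account for the first summand. For the other pairs the new
maximum puts all inversions before `p` among the counted ones, so the threshold for `τ` is
`p` if `h ≤ p`, and `h - 1`, the number of old positions before `h`, if `p < h`. -/
theorem thrInv_insMax {n : ℕ} (h : ℕ) (p : Fin (n + 1)) (τ : Equiv.Perm (Fin n)) (hn : h ≤ n + 1) :
    thrInv h (insMax p τ) = (h - 1 - p) + thrInv (max (h - 1) p) τ := by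
  rw [thrInv, Fin.sum_univ_succAbove _ p]
  congr 1
  · have hsum : ∀ j : Fin (n + 1),
        (if (p < j ∧ insMax p τ j < insMax p τ p) ∧
            ((j : ℕ) < h ∨ ∃ l, j < l ∧ insMax p τ p < insMax p τ l) then 1 else 0) =
          if (j : ℕ) ∈ Finset.Ico (p + 1 : ℕ) h then 1 else 0 := fun j => by
      have hj : p < j → insMax p τ j < insMax p τ p := fun hpj => by
        rw [insMax_self, Fin.lt_last_iff_ne_last, ← insMax_self p τ,
          (insMax p τ).injective.ne_iff]
        exact hpj.ne'
      have hl : ∀ l, ¬ insMax p τ p < insMax p τ l := fun l => by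
        rw [insMax_self]
        exact (Fin.le_last _).not_gt
      refine if_congr ?_ rfl rfl
      simp only [hl, and_false, exists_false, or_false, Finset.mem_Ico, and_iff_left_of_imp hj]
      rw [Fin.lt_def, Nat.succ_le_iff]
    rw [Finset.sum_congr rfl fun j _ => hsum j,
      Fin.sum_univ_eq_sum_range (fun j => if j ∈ Finset.Ico (p + 1 : ℕ) h then 1 else 0),
      ← Finset.card_filter, Finset.filter_mem_eq_inter,
      Finset.inter_eq_right.2 (fun j hj => by
        simp only [Finset.mem_Ico, Finset.mem_range] at hj ⊢; omega), Nat.card_Ico]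
    omega
  · rw [thrInv]
    refine Finset.sum_congr rfl fun i _ => ?_
    rw [Fin.sum_univ_succAbove _ p, if_neg, zero_add]
    · refine Finset.sum_congr rfl fun j _ => ?_
      refine if_congr ?_ rfl rfl
      rw [exists_succAbove_lt_iff, insMax_succAbove, insMax_succAbove,
        Fin.succAbove_lt_succAbove_iff, Fin.castSucc_lt_castSucc_iff,
        ← or_assoc, val_succAbove]
      refine and_congr_right fun _ => or_congr_left ?_
      split_ifs <;> omega
    · rw [insMax_self]
      exact fun hc => (Fin.le_last _).not_gt hc.1.2

theorem thrRlm_insMax {n : ℕ} (h : ℕ) (p : Fin (n + 1)) (τ : Equiv.Perm (Fin n)) :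
    thrRlm h (insMax p τ) = (if h ≤ p then 1 else 0) + thrRlm (max (h - 1) p) τ := by
  rw [thrRlm, Fin.sum_univ_succAbove _ p]
  congr 1
  · congr 1
    rw [eq_iff_iff, and_iff_left_iff_imp]
    intro _ j hj
    rw [insMax_self, Fin.lt_last_iff_ne_last, ← insMax_self p τ, (insMax p τ).injective.ne_iff]
    exact hj.ne'
  · rw [thrRlm]
    refine Finset.sum_congr rfl fun i _ => ?_
    congr 1
    rw [eq_iff_iff, Fin.forall_iff_succAbove p]
    simp only [insMax_self, insMax_succAbove, Fin.succAbove_lt_succAbove_iff,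
      Fin.castSucc_lt_castSucc_iff, (Fin.le_last _).not_gt, imp_false, not_lt]
    rw [← and_assoc]
    refine and_congr_left fun _ => ?_
    rw [Fin.le_def, val_succAbove]
    split_ifs <;> omega

/-! ### The recurrence for the threshold generating function -/

section GeneratingFunction

variable {K : Type*} [CommRing K] (q : K)

/-- The generating function by `thrInv h` of the permutations of `Fin n` with `thrRlm h`
equal to `k`. -/
def thrGF (n k h : ℕ) : K :=
  ∑ σ : Equiv.Perm (Fin n), if thrRlm h σ = k then q ^ thrInv h σ else 0

theorem thrGF_zero_right (n k : ℕ) : thrGF q n k 0 = qStirlingFirst q n k := by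
  simp only [thrGF, qStirlingFirst, Finset.sum_filter, thrInv_zero, thrRlm_zero]

theorem thrGF_zero_left (k : ℕ) : thrGF q 0 k 0 = if k = 0 then 1 else 0 := by
  simp [thrGF, thrRlm, thrInv, eq_comm]

theorem thrGF_succ (n k h : ℕ) (hn : h ≤ n + 1) :
    thrGF q (n + 1) k h = ∑ p ∈ Finset.range (n + 1),
      if p < h then q ^ (h - 1 - p) * thrGF q n k (h - 1)
      else if k = 0 then 0 else thrGF q n (k - 1) p := by
  rw [thrGF, ← (insMax_bijective n).sum_comp, Fintype.sum_prod_type, ← Fin.sum_univ_eq_sum_range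
    (fun p => if p < h then q ^ (h - 1 - p) * thrGF q n k (h - 1)
      else if k = 0 then 0 else thrGF q n (k - 1) p)]
  refine Finset.sum_congr rfl fun p _ => ?_
  simp only [thrInv_insMax h p _ hn, thrRlm_insMax]
  by_cases hp : (p : ℕ) < h
  · simp only [if_pos hp, if_neg hp.not_ge, max_eq_left (by omega : (p : ℕ) ≤ h - 1), zero_add,
      thrGF, Finset.mul_sum, pow_add, mul_ite, mul_zero]
  · simp only [if_neg hp, if_pos (not_lt.1 hp), max_eq_right (by omega : h - 1 ≤ (p : ℕ)),
      show h - 1 - (p : ℕ) = 0 by omega, zero_add]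
    rcases k with _ | k
    · simp
    · simp [thrGF, add_comm 1]

theorem thrGF_succ_eq (n k h : ℕ) (hn : h ≤ n + 1) :
    thrGF q (n + 1) k h = qInt q h * thrGF q n k (h - 1) +
      ∑ p ∈ Finset.Ico h (n + 1), if k = 0 then 0 else thrGF q n (k - 1) p := by
  rw [thrGF_succ q n k h hn, Finset.range_eq_Ico,
    ← Finset.sum_Ico_consecutive _ (Nat.zero_le h) hn, ← Finset.range_eq_Ico, qInt,
    ← Finset.sum_range_reflect, Finset.sum_mul]
  congr 1
  · refine Finset.sum_congr rfl fun p hp => ?_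
    rw [Finset.mem_range] at hp
    rw [if_pos (by omega), show h - 1 - (h - 1 - p) = p by omega]
  · refine Finset.sum_congr rfl fun p hp => ?_
    rw [if_neg (Finset.mem_Ico.1 hp).1.not_gt]

theorem thrGF_succ_self (n k : ℕ) :
    thrGF q (n + 1) k (n + 1) = qInt q (n + 1) * thrGF q n k n := by
  rw [thrGF_succ_eq q n k (n + 1) le_rfl]
  simp

theorem thrGF_succ_sub (n k h : ℕ) (hn : h ≤ n) :
    thrGF q (n + 1) k h - qInt q h * thrGF q n k (h - 1) =
      thrGF q (n + 1) k (h + 1) - qInt q (h + 1) * thrGF q n k h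
        + if k = 0 then 0 else thrGF q n (k - 1) h := by
  rw [thrGF_succ_eq q n k h (by omega), thrGF_succ_eq q n k (h + 1) (by omega),
    Finset.sum_eq_sum_Ico_succ_bot (by omega : h < n + 1), Nat.add_sub_cancel]
  ring

end GeneratingFunction

/-! ### The closed form -/

section ClosedForm

variable {K : Type*} [CommRing K] (q : K)

/-- The quantity `R_{n,k}(h)` in closed form. Up to the factors `(1 - q) ^ (n - k)` and `[h]_q!` it
counts, by `thrInv h`, the permutations of `Fin (h + n)` with `k` right-to-left maxima, all of them
at positions `≥ h`; hence the value at `n = 0`. The truncation `M` of the double sum is irrelevant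
once `n ≤ M`. -/
def levelSum (M : ℕ) : ℕ → ℕ → ℕ → K
  | 0, k, h => if k = 0 ∧ h = 0 then 1 else 0
  | _ + 1, 0, _ => 0
  | n + 1, v + 1, h => kernelSum q (fun x y => (binomDet v x y : K)) M h (n + h) n

theorem levelSum_one {M : ℕ} (hM : 1 ≤ M) (k h : ℕ) :
    levelSum q M 1 k h = if k = 1 then 1 else 0 := by
  rcases k with _ | v
  · simp [levelSum]
  · rw [levelSum, kernelSum, Finset.sum_eq_single_of_mem 0 (Finset.mem_range.2 hM),
      Finset.sum_eq_single_of_mem 0 (Finset.mem_range.2 hM)]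
    · rcases v with _ | v
      · simp [kernelCoeff_zero_zero, binomDet_zero (Int.natCast_nonneg h)]
      · simp [binomDet_of_lt (v := v + 1) (h : ℤ) (y := 0) (by positivity)]
    · intro d _ hd
      rw [kernelCoeff_eq_zero q (Nat.pos_of_ne_zero hd), zero_mul]
    · intro m _ hm
      refine Finset.sum_eq_zero fun d _ => ?_
      rw [binomDet_of_neg _ _ (by simp; omega), Int.cast_zero, mul_zero]

/-- Lowering `k` by one takes the second difference in the arguments of the determinants. -/
theorem levelSum_succ_eq (M n v h : ℕ) :
    levelSum q M (n + 1) v h =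
      kernelSum q (fun x y => (binomDet v x y : K)) M h (n + h + 1) (n + 1)
        - kernelSum q (fun x y => (binomDet v x y : K)) M h (n + h) (n + 1)
        - kernelSum q (fun x y => (binomDet v x y : K)) M h (n + h + 1) n
        + kernelSum q (fun x y => (binomDet v x y : K)) M h (n + h) n := by
  have key : ∀ m d : ℕ,
      (binomDet v (n + h + 1 + d) (n + 1 - m) - binomDet v (n + h + d) (n + 1 - m)
        - binomDet v (n + h + 1 + d) (n - m) + binomDet v (n + h + d) (n - m) : ℤ) =
      if v = 0 then 0 else binomDet (v - 1) (n + h + d) (n - m) := fun m d => by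
    rcases v with _ | v
    · simp only [binomDet_zero (by positivity : (0 : ℤ) ≤ n + h + 1 + d),
        binomDet_zero (by positivity : (0 : ℤ) ≤ n + h + d)]
      simp
    · rw [if_neg v.succ_ne_zero, Nat.add_sub_cancel,
        ← binomDet_second_difference v (n + h + d) (n - m), add_right_comm _ (1 : ℤ) (d : ℤ),
        ← sub_add_eq_add_sub]
  simp only [kernelSum, ← Finset.sum_sub_distrib, ← Finset.sum_add_distrib, ← mul_sub, ← mul_add,
    ← Int.cast_sub, ← Int.cast_add, key]
  rcases v with _ | v
  · simp [levelSum]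
  · simp [levelSum, kernelSum]

theorem levelSum_succ {M n : ℕ} (hM : n + 1 ≤ M) (k h : ℕ) :
    levelSum q M (n + 1) k h = (1 - q ^ (h + 1)) * levelSum q M n k (h + 1) +
      if k = 0 then 0 else ∑ g ∈ Finset.range (h + 1), levelSum q M n (k - 1) g := by
  rcases k with _ | v
  · rcases n with _ | n <;> simp [levelSum]
  rcases n with _ | n
  · rw [levelSum_one q hM]
    simp [levelSum, Finset.sum_range_succ' _ h]
  have step : ∀ h : ℕ, levelSum q M (n + 2) (v + 1) h -
      prevSum q (fun x y => (binomDet v x y : K)) M h (n + h) (n + 1) =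
      (1 - q ^ (h + 1)) * levelSum q M (n + 1) (v + 1) (h + 1)
        - (1 - q ^ h) * levelSum q M (n + 1) (v + 1) h + levelSum q M (n + 1) v h := fun h => by
    have hk := kernelSum_sub_prevSum q (fun x y => (binomDet v x y : K)) (M := M) (x := n + h)
      (y := n) (by omega) h (fun u w hw => by simp [binomDet_of_neg v u hw])
      (fun h0 => by simp [h0, binomDet_self_succ])
    rw [levelSum_succ_eq q M n v h]
    simp only [levelSum]
    push_cast
    rw [add_right_comm (n : ℤ) 1 h, ← add_assoc (n : ℤ) h 1]
    linear_combination hk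
  simp only [if_neg v.succ_ne_zero, Nat.add_sub_cancel]
  induction h with
  | zero =>
    have := step 0
    simp only [prevSum, pow_zero] at this
    rw [zero_add, Finset.sum_range_one]
    linear_combination this
  | succ h ih =>
    have hs := step (h + 1)
    have hp : prevSum q (fun x y => (binomDet v x y : K)) M (h + 1) (n + (h + 1 : ℕ)) (n + 1) =
        levelSum q M (n + 2) (v + 1) h := by
      simp only [prevSum, levelSum]
      congr 1
      push_cast
      ring
    rw [Finset.sum_range_succ]
    linear_combination hs + hp + ih

theorem thrGF_self (n k : ℕ) : thrGF q n k n = if k = 0 then qFact q n else 0 := by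
  induction n with
  | zero => rw [thrGF_zero_left, qFact_zero]
  | succ n ih =>
    rw [thrGF_succ_self, ih, qFact_succ]
    split_ifs <;> ring

/-- The threshold generating function in closed form. The summand `g` belongs to the permutations
in which exactly `g` of the first `h` entries are smaller than some entry at a position `≥ h`. -/
theorem one_sub_pow_mul_thrGF {M n : ℕ} (hM : n ≤ M) (k h : ℕ) :
    (1 - q) ^ n * thrGF q (h + n) k h =
      (1 - q) ^ k * qFact q h * ∑ g ∈ Finset.range (h + 1), levelSum q M n k g := by
  induction n generalizing k h with
  | zero =>
    rw [add_zero, thrGF_self, Finset.sum_range_succ']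
    split_ifs with hk <;> simp [hk, levelSum]
  | succ n ih =>
    have ih := ih (by omega)
    -- For `h = 0` the hypothesis is trivial, since `[0]_q = 0` makes `h - 1` irrelevant.
    have hstep : ∀ h : ℕ, (1 - q) ^ (n + 1) * (qInt q h * thrGF q (h + n) k (h - 1)) =
          (1 - q) ^ k * qFact q h * ∑ g ∈ Finset.range h, levelSum q M (n + 1) k g →
        (1 - q) ^ (n + 1) * thrGF q (h + (n + 1)) k h =
          (1 - q) ^ k * qFact q h *
            ∑ g ∈ Finset.range (h + 1), levelSum q M (n + 1) k g := fun h hprev => by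
      have hrec := thrGF_succ_sub q (h + n) k h (by omega)
      have h₁ := ih k (h + 1)
      have h₂ := ih k h
      rw [Finset.sum_range_succ, qFact_succ, show h + 1 + n = h + n + 1 by omega] at h₁
      have hq := one_sub_mul_qInt q (h + 1)
      rw [Finset.sum_range_succ, levelSum_succ q hM, ← add_assoc h n 1]
      rcases k with _ | k
      · simp only [if_true] at hrec ⊢
        linear_combination (1 - q) ^ (n + 1) * hrec + hprev + (1 - q) * h₁
          - (1 - q) * qInt q (h + 1) * h₂ + qFact q h * levelSum q M n 0 (h + 1) * hq
      · have h₃ := ih k h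
        simp only [if_neg k.succ_ne_zero, Nat.add_sub_cancel] at hrec ⊢
        linear_combination (1 - q) ^ (n + 1) * hrec + hprev + (1 - q) * h₁
          - (1 - q) * qInt q (h + 1) * h₂ + (1 - q) * h₃
          + (1 - q) ^ (k + 1) * qFact q h * levelSum q M n (k + 1) (h + 1) * hq
    induction h with
    | zero => exact hstep 0 (by simp [qInt])
    | succ h ihh =>
      refine hstep (h + 1) ?_
      rw [Nat.add_sub_cancel, show h + 1 + n = h + (n + 1) by omega, qFact_succ]
      linear_combination qInt q (h + 1) * ihh

theorem levelSum_eq_sum_coeffB (n k : ℕ) (hk : k ≤ n) :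
    levelSum q (n + 1) n k 0 =
      ∑ j ∈ Finset.range (n - k + 1), ∑ i ∈ Finset.Icc j (n - k),
        (-1) ^ j * (coeffB n k i j : K) * q ^ (j + 1).choose 2 * gauss q i j := by
  rcases n with _ | n
  · obtain rfl : k = 0 := by omega
    simp [levelSum, coeffB, binomZ]
  rcases k with _ | v
  · simp [levelSum, coeffB_zero n.succ_pos]
  rw [levelSum, kernelSum, Finset.sum_comm]
  have hterm : ∀ i j : ℕ, kernelCoeff q 0 i j *
        (binomDet v ((n : ℤ) + (0 : ℕ) + j) (n - i) : K) =
      (-1) ^ j * (coeffB (n + 1) (v + 1) i j : K) * q ^ (j + 1).choose 2 * gauss q i j :=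
    fun i j => by
      rw [coeffB_succ, kernelCoeff, zero_add, add_zero, gauss_zero_right,
        show ((n + 1 : ℕ) : ℤ) + j - 1 = n + (0 : ℕ) + j by push_cast; ring,
        show ((n + 1 : ℕ) : ℤ) - i - 1 = n - i by push_cast; ring]
      ring
  have hzero : ∀ i j : ℕ, (i < j ∨ n - v < i) → kernelCoeff q 0 i j *
      (binomDet v ((n : ℤ) + (0 : ℕ) + j) (n - i) : K) = 0 := fun i j hij => by
    rcases hij with hij | hij
    · rw [kernelCoeff_eq_zero q hij, zero_mul]
    · rw [binomDet_of_lt _ (by omega : (n : ℤ) - i < v), Int.cast_zero, mul_zero]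
  rw [Nat.add_sub_add_right]
  symm
  refine (Finset.sum_subset (Finset.range_subset_range.2 (by omega)) fun j _ hj => ?_).trans
    (Finset.sum_congr rfl fun j _ => ?_)
  · rw [Finset.Icc_eq_empty (by simpa using hj), Finset.sum_empty]
  · simp only [← hterm]
    refine Finset.sum_subset (fun i hi => ?_) fun i _ hi => hzero i j ?_
    · rw [Finset.mem_Icc] at hi
      rw [Finset.mem_range]
      omega
    · rw [Finset.mem_Icc] at hi
      omega

end ClosedForm

/-! ### Specialization to rational functions -/

theorem ratFunc_one_sub_X_pow_ne_zero {m : ℕ} (hm : 0 < m) :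
    1 - (RatFunc.X : RatFunc ℚ) ^ m ≠ 0 := by
  intro h
  have h' : algebraMap (Polynomial ℚ) (RatFunc ℚ) (Polynomial.X ^ m - Polynomial.C 1) = 0 := by
    rw [map_sub, map_pow, RatFunc.algebraMap_X, map_one, map_one, ← neg_sub, h, neg_zero]
  exact Polynomial.X_pow_sub_C_ne_zero hm 1
    ((map_eq_zero_iff _ (IsFractionRing.injective _ _)).1 h')

theorem qFact_ratFunc_X_ne_zero (m : ℕ) : qFact (RatFunc.X : RatFunc ℚ) m ≠ 0 := by
  refine Finset.prod_ne_zero_iff.2 fun i hi h => ?_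
  have := one_sub_mul_qInt (RatFunc.X : RatFunc ℚ) i
  rw [h, mul_zero] at this
  exact ratFunc_one_sub_X_pow_ne_zero (Finset.mem_Icc.1 hi).1 this.symm

theorem qBinom_ratFunc_X {i j : ℕ} (hij : j ≤ i) :
    qBinom (RatFunc.X : RatFunc ℚ) i j = gauss RatFunc.X i j := by
  have h := gauss_mul_qFact (RatFunc.X : RatFunc ℚ) j (i - j)
  rw [Nat.add_sub_cancel' hij] at h
  rw [qBinom, if_pos hij, ← h, mul_div_cancel_right₀]
  exact mul_ne_zero (qFact_ratFunc_X_ne_zero _) (qFact_ratFunc_X_ne_zero _)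

end QStirling

theorem mainTheorem3 (n k : ℕ) (hk : k ≤ n) :
    (1 - (RatFunc.X : RatFunc ℚ)) ^ (n - k) *
        QStirling.qStirlingFirst (RatFunc.X : RatFunc ℚ) n k =
      ∑ j ∈ Finset.range (n - k + 1), ∑ i ∈ Finset.Icc j (n - k),
        (-1) ^ j * (QStirling.coeffB n k i j : RatFunc ℚ) *
          (RatFunc.X : RatFunc ℚ) ^ (j + 1).choose 2 *
            QStirling.qBinom (RatFunc.X : RatFunc ℚ) i j := by
  have hne : (1 - (RatFunc.X : RatFunc ℚ)) ^ k ≠ 0 := by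
    simpa using pow_ne_zero k (QStirling.ratFunc_one_sub_X_pow_ne_zero one_pos)
  have h := QStirling.one_sub_pow_mul_thrGF (RatFunc.X : RatFunc ℚ) (Nat.le_succ n) k 0
  rw [zero_add, zero_add, Finset.sum_range_one, QStirling.qFact_zero, mul_one,
    QStirling.thrGF_zero_right, QStirling.levelSum_eq_sum_coeffB _ n k hk,
    ← Nat.add_sub_cancel' hk, pow_add, mul_assoc, Nat.add_sub_cancel' hk] at h
  rw [mul_left_cancel₀ hne h]
  refine Finset.sum_congr rfl fun j _ => Finset.sum_congr rfl fun i hi => ?_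
  rw [QStirling.qBinom_ratFunc_X (Finset.mem_Icc.1 hi).1]
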